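/- Let Alice hold $\mathbb{C}^6$ with orthonormal basis $|0\rangle,\dots,|5\rangle$, Bob-1 hold $\mathbb{C}^5$ with orthonormal basis $|0\rangle,\dots,|4\rangle$, and Bob-2 hold $\mathbb{C}^5$ with orthonormal basis $|1\rangle,\dots,|5\rangle$. Put $$|\alpha_\pm\rangle=\tfrac{1}{\sqrt2}(|1\rangle\pm|2\rangle),\quad |\beta_\pm\rangle=\tfrac{1}{\sqrt2}(|2\rangle\pm|3\rangle),\quad |\gamma_\pm\rangle=\tfrac{1}{\sqrt2}(|2\rangle\pm|4\rangle),$$ and for $i,j,k\in\{0,1\}$ with $i+j+k$ even let $|\Psi_{ijk}\rangle$, $|\Phi_{ijk}\rangle$, $|\Upsilon_{ijk}\rangle$ be the vectors $$\tfrac12\left(|a\rangle+(-1)^i|b\rangle+(-1)^j|c\rangle+(-1)^k|d\rangle\right)$$ with $(a,b,c,d)=(0,1,2,3)$, $(1,2,3,4)$ and $(1,2,4,5)$, respectively. Let $\Sigma\subset\mathbb{C}^6\otimes\mathbb{C}^5\otimes\mathbb{C}^5$ be the set of the $42$ states (tensor factors in the order Alice, Bob-1, Bob-2) $$\begin{aligned}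 &|1\rangle|\alpha_\pm\rangle|4\rangle,\ |\alpha_\pm\rangle|3\rangle|4\rangle,\ |3\rangle|\beta_\pm\rangle|4\rangle,\ |\beta_\pm\rangle|1\rangle|4\rangle,\ |4\rangle|3\rangle|\gamma_\pm\rangle,\ |\gamma_\pm\rangle|3\rangle|1\rangle,\ |1\rangle|3\rangle|\alpha_\pm\rangle,\\ &|0\rangle|\Psi_{ijk}\rangle|3\rangle,\ |\Psi_{ijk}\rangle|4\rangle|3\rangle,\ |4\rangle|\Phi_{ijk}\rangle|3\rangle,\ |\Phi_{ijk}\rangle|0\rangle|3\rangle,\ |5\rangle|0\rangle|\Phi_{ijk}\rangle,\ |\Upsilon_{ijk}\rangle|0\rangle|5\rangle,\ |3\rangle|0\rangle|\Upsilon_{ijk}\rangle . \end{aligned}$$ Then $\Sigma$ is a genuinely nonlocal set of product states: its elements are pairwise orthogonal, fully product unit vectors, and for every bipartition of the three parties into two non-empty groups (each group acting jointly as one party), the states of $\Sigma$ cannot be perfectly distinguished by local operations and classical communication (LOCC) between the two groups. Here an LOCC protocol may have any number of rounds, possibly infinitely many, each round consisting of a local measurement with finitely many outcomes (local ancillas allowed)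 whose outcome is announced; perfect distinguishability means that for some protocol and some rule for guessing the state from the announced outcomes, for every state of $\Sigma$ the probability that the guess after $n$ rounds is correct tends to $1$ as $n\to\infty$ (for a protocol with finitely many rounds: the final guess is correct with probability $1$). -/

import Mathlib

noncomputable section

/-- State vectors of a composite system: party `p` holds `ℂ^(σ p)` with orthonormal basis `σ p`,
and the tensor product `⨂ p, ℂ^(σ p)` has the orthonormal basis `∀ p, σ p`. -/
abbrev StateVec {P : Type} (σ : P → Type) [Fintype (∀ p, σ p)] : Type :=
  EuclideanSpace ℂ (∀ p, σ p)

/-- The product vector `⨂ p, φ p`. -/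
def productVec {P : Type} [Fintype P] {σ : P → Type} [Fintype (∀ p, σ p)]
    (φ : ∀ p, EuclideanSpace ℂ (σ p)) : StateVec σ :=
  WithLp.toLp 2 fun i => ∏ p, φ p (i p)

/-- The action of the local operators `⨂ p, A p` on a state vector. -/
def applyLocal {P : Type} [Fintype P] {σ τ : P → Type}
    [Fintype (∀ p, σ p)] [Fintype (∀ p, τ p)]
    (A : ∀ p, Matrix (τ p) (σ p) ℂ) (ψ : StateVec σ) : StateVec τ :=
  WithLp.toLp 2 fun j => ∑ i, (∏ p, A p (j p) (i p)) * ψ i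

/-- An LOCC protocol with no bound on the number of rounds. The classical record `h` is the list
of all outcomes announced so far, the most recent one first. First every party may attach an
ancilla (a local isometry). In each round, depending on the record, one party (`actor h`) performs
a local measurement with finitely many outcomes `o < outcomes h` and Kraus operators
`kraus (actor h) h o` and announces the outcome; each other party may then apply a local isometry
that depends on the record. The local dimensions may change from round to round, so that ancillas
can be added or discarded at any time. A protocol with finitely many rounds is one in which,
from some round on, all local operations are trivial. -/
structure LOCCProtocol (P : Type) (σ : P → Type) [∀ p, Fintype (σ p)]
    [∀ p, DecidableEq (σ p)] where
  /-- the dimension of the system of each party after a given record -/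
  dim : P → List ℕ → ℕ
  prep : ∀ p, Matrix (Fin (dim p [])) (σ p) ℂ
  prep_isometry : ∀ p, (prep p).conjTranspose * prep p = 1
  actor : List ℕ → P
  outcomes : List ℕ → ℕ
  kraus : ∀ (p : P) (h : List ℕ) (o : ℕ), Matrix (Fin (dim p (o :: h))) (Fin (dim p h)) ℂ
  kraus_complete : ∀ h, ∑ o ∈ Finset.range (outcomes h),
    (kraus (actor h) h o).conjTranspose * kraus (actor h) h o = 1
  kraus_isometry : ∀ h, ∀ o < outcomes h, ∀ p ≠ actor h,
    (kraus p h o).conjTranspose * kraus p h o = 1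

namespace LOCCProtocol

variable {P : Type} {σ : P → Type} [∀ p, Fintype (σ p)] [∀ p, DecidableEq (σ p)]

/-- The composition of all the operators that party `p` has applied when the record is `h`. -/
def accumulated (π : LOCCProtocol P σ) (p : P) :
    (h : List ℕ) → Matrix (Fin (π.dim p h)) (σ p) ℂ
  | [] => π.prep p
  | o :: h => π.kraus p h o * π.accumulated p h

/-- The records that are possible after `n` rounds. -/
def records (π : LOCCProtocol P σ) : ℕ → Finset (List ℕ)
  | 0 => {[]}
  | n + 1 => (π.records n).biUnion fun h =>
      (Finset.range (π.outcomes h)).image fun o => o :: h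

variable [Fintype P] [DecidableEq P]

/-- The probability of the record `h` when the system is initially in the state `ψ`. -/
def recordProb (π : LOCCProtocol P σ) (ψ : StateVec σ) (h : List ℕ) : ℝ :=
  ‖applyLocal (fun p => π.accumulated p h) ψ‖ ^ 2

open Classical in
/-- The probability that after `n` rounds the guess based on the record is right, if the state of
the system is initially `ψ`. -/
def successProb (π : LOCCProtocol P σ) (guess : List ℕ → StateVec σ) (n : ℕ)
    (ψ : StateVec σ) : ℝ :=
  ∑ h ∈ (π.records n).filter (fun h => guess h = ψ), π.recordProb ψ h

end LOCCProtocol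

/-- A set of states is perfectly distinguishable by LOCC if there are an LOCC protocol and a rule
that guesses the state from the record such that, for each state of the set, the probability
of a right guess after `n` rounds tends to `1` as `n` grows. For a protocol with finitely many
rounds this says that the final guess is right with probability `1`. -/
def LOCCDistinguishable {P : Type} [Fintype P] [DecidableEq P] {σ : P → Type}
    [∀ p, Fintype (σ p)] [∀ p, DecidableEq (σ p)] (S : Set (StateVec σ)) : Prop :=
  ∃ (π : LOCCProtocol P σ) (guess : List ℕ → StateVec σ), ∀ ψ ∈ S,
    Filter.Tendsto (fun n => π.successProb guess n ψ) Filter.atTop (nhds 1)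

/-- The same state when, for each `q`, the parties `i` with `f i = q` have come together
and act as one party `q`, which holds `⨂ i with f i = q, ℂ^(σ i)`. -/
def groupParties {P Q : Type} [Fintype P] [DecidableEq P] [Fintype Q] [DecidableEq Q]
    {σ : P → Type} [∀ p, Fintype (σ p)] (f : P → Q) (ψ : StateVec σ) :
    StateVec fun q : Q => ∀ i : {i : P // f i = q}, σ i :=
  WithLp.toLp 2 fun x => ψ fun i => x (f i) ⟨i, rfl⟩

/-- A genuinely nonlocal set of product states: a set of pairwise orthogonal, fully product
(normalized) states that cannot be perfectly distinguished by LOCC across any bipartition of the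
parties into two non-empty groups. -/
structure IsGNPS {P : Type} [Fintype P] [DecidableEq P] {σ : P → Type}
    [∀ p, Fintype (σ p)] [∀ p, DecidableEq (σ p)] (S : Set (StateVec σ)) : Prop where
  normalized : ∀ ψ ∈ S, ‖ψ‖ = 1
  product : ∀ ψ ∈ S, ∃ φ : ∀ p, EuclideanSpace ℂ (σ p), ψ = productVec φ
  orthogonal : S.Pairwise fun ψ φ => inner ℂ ψ φ = 0
  nonlocal : ∀ f : P → Bool, Function.Surjective f →
    ¬ LOCCDistinguishable (groupParties f '' S)

namespace SigmaStates

/-- The local dimensions of Alice (party `0`), Bob-1 (party `1`) and Bob-2 (party `2`). -/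
def dims : Fin 3 → ℕ := ![6, 5, 5]

/-- The basis vectors are labelled `0, …, 5` for Alice, `0, …, 4` for Bob-1
and `1, …, 5` for Bob-2; this is the first label of each party. -/
def firstLabel : Fin 3 → ℕ := ![0, 0, 1]

/-- A recipe for a local vector, to be used at any of the three parties. -/
abbrev LocalVec : Type := ∀ p : Fin 3, EuclideanSpace ℂ (Fin (dims p))

/-- The basis vector with label `l`. -/
def ket (l : ℕ) : LocalVec := fun p =>
  WithLp.toLp 2 fun i => if firstLabel p + (i : ℕ) = l then 1 else 0

/-- The vectors `(|a⟩ + (-1)^s |b⟩) / √2`. -/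
def pair (a b : ℕ) (s : Fin 2) : LocalVec := fun p =>
  ((1 / Real.sqrt 2 : ℝ) : ℂ) • (ket a p + (-1 : ℂ) ^ (s : ℕ) • ket b p)

/-- The vectors `(|a⟩ + (-1)^i |b⟩ + (-1)^j |c⟩ + (-1)^k |d⟩) / 2`. -/
def quad (a b c d : ℕ) (i j k : Fin 2) : LocalVec := fun p =>
  (1 / 2 : ℂ) • (ket a p + (-1 : ℂ) ^ (i : ℕ) • ket b p + (-1 : ℂ) ^ (j : ℕ) • ket c p
    + (-1 : ℂ) ^ (k : ℕ) • ket d p)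

/-- The product state `|a⟩_A ⊗ |b⟩_{B₁} ⊗ |c⟩_{B₂}`. -/
def tri (a b c : LocalVec) : StateVec fun p : Fin 3 => Fin (dims p) :=
  productVec fun p => (![a, b, c] : Fin 3 → LocalVec) p p

def alpha : Fin 2 → LocalVec := pair 1 2
def beta : Fin 2 → LocalVec := pair 2 3
def gamma : Fin 2 → LocalVec := pair 2 4
def Psi : Fin 2 → Fin 2 → Fin 2 → LocalVec := quad 0 1 2 3
def Phi : Fin 2 → Fin 2 → Fin 2 → LocalVec := quad 1 2 3 4
def Upsilon : Fin 2 → Fin 2 → Fin 2 → LocalVec := quad 1 2 4 5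

/-- The set `Σ` of `7 * 2 + 7 * 4` states in `ℂ⁶ ⊗ ℂ⁵ ⊗ ℂ⁵`. The sum `i + j + k` in `Fin 2`
is the sum modulo `2`. -/
def SigmaSet : Set (StateVec fun p : Fin 3 => Fin (dims p)) :=
  {ψ | (∃ s : Fin 2,
      ψ = tri (ket 1) (alpha s) (ket 4) ∨
      ψ = tri (alpha s) (ket 3) (ket 4) ∨
      ψ = tri (ket 3) (beta s) (ket 4) ∨
      ψ = tri (beta s) (ket 1) (ket 4) ∨
      ψ = tri (ket 4) (ket 3) (gamma s) ∨
      ψ = tri (gamma s) (ket 3) (ket 1) ∨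
      ψ = tri (ket 1) (ket 3) (alpha s)) ∨
    (∃ i j k : Fin 2, i + j + k = 0 ∧
     (ψ = tri (ket 0) (Psi i j k) (ket 3) ∨
      ψ = tri (Psi i j k) (ket 4) (ket 3) ∨
      ψ = tri (ket 4) (Phi i j k) (ket 3) ∨
      ψ = tri (Phi i j k) (ket 0) (ket 3) ∨
      ψ = tri (ket 5) (ket 0) (Phi i j k) ∨
      ψ = tri (Upsilon i j k) (ket 0) (ket 5) ∨
      ψ = tri (ket 3) (ket 0) (Upsilon i j k)))}

end SigmaStates

end

/-! Orthogonality is a finite computation: up to normalization all factors have integer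
coefficients.

For nonlocality, every bipartition separates Alice from Bob-1 or from Bob-2. With Bob-2 fixed at
`|4⟩`, or Bob-1 at `|3⟩`, four of the two-element families are the eight domino states (without the
central tile) on a 3×3 subspace shared by the separated parties. So it suffices that the domino
states are not distinguishable, even in the limit of infinitely many rounds.

After a record the two groups are described by Gram matrices `E`, `F` on `ℂ³`, initially the
identity. A round splits one of them into a sum over the outcomes and keeps the other. The
`potential` is the total overlap of distinct domino states or, if both matrices are nearly scalar
and this is larger, `tr E · tr F / 180`. Its sum over the records cannot decrease: overlaps obey the
triangle inequality, and when a round moves one matrix away from scalar, the other is still nearly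
scalar, so the violated condition shows up as a large overlap (`le_overlap_of_right_nearScalar`,
`le_overlap_of_left_nearScalar`). The sum therefore stays at least `1/20` (`le_sum_potential`). By
`potential_le` it is bounded by the Bhattacharyya overlaps of the record distributions, which
perfect discrimination forces to `0` (`tendsto_overlap`). -/

open Matrix
open scoped ComplexOrder

noncomputable section

/-! ### Product vectors and local operators -/

section ProductVectors

variable {P : Type} [Fintype P] [DecidableEq P] {σ τ : P → Type} [∀ p, Fintype (σ p)]
  [∀ p, Fintype (τ p)]

theorem inner_productVec (φ χ : ∀ p, EuclideanSpace ℂ (σ p)) :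
    inner ℂ (productVec φ) (productVec χ) = ∏ p, inner ℂ (φ p) (χ p) := by
  simp only [productVec, PiLp.inner_apply, RCLike.inner_apply]
  rw [Finset.prod_univ_sum, Fintype.piFinset_univ]
  simp [Finset.prod_mul_distrib]

theorem norm_productVec (φ : ∀ p, EuclideanSpace ℂ (σ p)) :
    ‖productVec φ‖ = ∏ p, ‖φ p‖ := by
  have h : ‖productVec φ‖ ^ 2 = (∏ p, ‖φ p‖) ^ 2 := by
    have := inner_productVec φ φ
    simp only [inner_self_eq_norm_sq_to_K] at this
    rw [← Finset.prod_pow]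
    exact_mod_cast this
  exact (pow_left_inj₀ (norm_nonneg _) (Finset.prod_nonneg fun _ _ => norm_nonneg _)
    two_ne_zero).1 h

theorem applyLocal_productVec (A : ∀ p, Matrix (τ p) (σ p) ℂ)
    (φ : ∀ p, EuclideanSpace ℂ (σ p)) :
    applyLocal A (productVec φ) = productVec fun p => WithLp.toLp 2 (A p *ᵥ (φ p).ofLp) := by
  ext j
  simp only [applyLocal, productVec, mulVec, dotProduct]
  rw [Finset.prod_univ_sum, Fintype.piFinset_univ]
  simp [Finset.prod_mul_distrib]

end ProductVectors

/-! ### Sesquilinear forms of positive semidefinite matrices -/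

section Forms

variable {ι κ : Type} [Fintype ι] [Fintype κ]

/-- The sesquilinear form `⟨x, G y⟩` of a square matrix. -/
def matrixForm (G : Matrix ι ι ℂ) (x y : ι → ℂ) : ℂ := star x ⬝ᵥ (G *ᵥ y)

theorem matrixForm_conjTranspose_mul_self (B : Matrix κ ι ℂ) (x y : ι → ℂ) :
    matrixForm (Bᴴ * B) x y = inner ℂ (WithLp.toLp 2 (B *ᵥ x)) (WithLp.toLp 2 (B *ᵥ y)) := by
  rw [matrixForm, EuclideanSpace.inner_eq_star_dotProduct, ← mulVec_mulVec, dotProduct_mulVec,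
    vecMul_conjTranspose, star_star, dotProduct_comm]

theorem matrixForm_self_re (B : Matrix κ ι ℂ) (x : ι → ℂ) :
    (matrixForm (Bᴴ * B) x x).re = ‖WithLp.toLp 2 (B *ᵥ x)‖ ^ 2 := by
  rw [matrixForm_conjTranspose_mul_self, inner_self_eq_norm_sq_to_K]
  norm_cast

theorem matrixForm_sum {α : Type} (s : Finset α) (G : α → Matrix ι ι ℂ) (x y : ι → ℂ) :
    matrixForm (∑ o ∈ s, G o) x y = ∑ o ∈ s, matrixForm (G o) x y := by
  simp only [matrixForm, sum_mulVec, dotProduct_sum]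

open scoped MatrixOrder Matrix.Norms.L2Operator in
theorem exists_eq_conjTranspose_mul_self {G : Matrix ι ι ℂ} (hG : G.PosSemidef) :
    ∃ B : Matrix ι ι ℂ, G = Bᴴ * B := by
  classical
  exact CStarAlgebra.nonneg_iff_eq_star_mul_self.mp hG.nonneg

theorem matrixForm_self_re_nonneg {G : Matrix ι ι ℂ} (hG : G.PosSemidef) (x : ι → ℂ) :
    0 ≤ (matrixForm G x x).re := by
  obtain ⟨B, rfl⟩ := exists_eq_conjTranspose_mul_self hG
  rw [matrixForm_self_re]
  positivity

/-- Cauchy–Schwarz for the vectors `B x` and `B y`, where `G = Bᴴ B`. -/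
theorem norm_matrixForm_le {G : Matrix ι ι ℂ} (hG : G.PosSemidef) (x y : ι → ℂ) :
    ‖matrixForm G x y‖ ≤ √(matrixForm G x x).re * √(matrixForm G y y).re := by
  obtain ⟨B, rfl⟩ := exists_eq_conjTranspose_mul_self hG
  rw [matrixForm_self_re, matrixForm_self_re, Real.sqrt_sq (norm_nonneg _),
    Real.sqrt_sq (norm_nonneg _), matrixForm_conjTranspose_mul_self]
  exact norm_inner_le_norm _ _

end Forms

/-! ### Gram matrices and record probabilities along a protocol -/

namespace LOCCProtocol

variable {P : Type} {σ : P → Type} [∀ p, Fintype (σ p)] [∀ p, DecidableEq (σ p)]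
  {ι : Type}

theorem sum_records_succ (π : LOCCProtocol P σ) (n : ℕ) (g : List ℕ → ℝ) :
    ∑ h ∈ π.records (n + 1), g h
      = ∑ h ∈ π.records n, ∑ o ∈ Finset.range (π.outcomes h), g (o :: h) := by
  rw [records, Finset.sum_biUnion]
  · refine Finset.sum_congr rfl fun h _ => ?_
    rw [Finset.sum_image]
    intro a _ b _ hab
    exact (List.cons.inj hab).1
  · intro h _ h' _ hne
    simp only [Function.onFun, Finset.disjoint_left, Finset.mem_image]
    rintro _ ⟨o, _, rfl⟩ ⟨o', _, he⟩
    exact hne (List.cons.inj he).2.symm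

/-- The Gram matrix of the vectors to which party `p` has mapped the columns of `V p` when the
record is `h`. -/
def gram (π : LOCCProtocol P σ) (V : ∀ p, Matrix (σ p) ι ℂ) (p : P) (h : List ℕ) :
    Matrix ι ι ℂ :=
  (π.accumulated p h * V p)ᴴ * (π.accumulated p h * V p)

variable (π : LOCCProtocol P σ) (V : ∀ p, Matrix (σ p) ι ℂ)

theorem gram_posSemidef [Finite ι] (p : P) (h : List ℕ) : (π.gram V p h).PosSemidef :=
  posSemidef_conjTranspose_mul_self _

theorem gram_nil [DecidableEq ι] (hV : ∀ p, (V p)ᴴ * V p = 1) (p : P) : π.gram V p [] = 1 := by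
  rw [gram, accumulated, conjTranspose_mul, Matrix.mul_assoc, ← Matrix.mul_assoc (π.prep p)ᴴ,
    π.prep_isometry, Matrix.one_mul, hV]

theorem gram_cons (p : P) (h : List ℕ) (o : ℕ) :
    π.gram V p (o :: h) = (π.accumulated p h * V p)ᴴ *
      ((π.kraus p h o)ᴴ * π.kraus p h o) * (π.accumulated p h * V p) := by
  simp only [gram, accumulated, conjTranspose_mul, Matrix.mul_assoc]

/-- Completeness of the Kraus operators. Together with `gram_cons_of_ne_actor` this describes a
round at the level of Gram matrices: the actor's matrix splits into a sum, the others stay. -/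
theorem sum_gram_actor (h : List ℕ) :
    ∑ o ∈ Finset.range (π.outcomes h), π.gram V (π.actor h) (o :: h)
      = π.gram V (π.actor h) h := by
  simp only [gram_cons]
  rw [← Matrix.sum_mul, ← Matrix.mul_sum, π.kraus_complete, Matrix.mul_one, gram]

theorem gram_cons_of_ne_actor {p : P} {h : List ℕ} {o : ℕ} (ho : o < π.outcomes h)
    (hp : p ≠ π.actor h) : π.gram V p (o :: h) = π.gram V p h := by
  rw [gram_cons, π.kraus_isometry h o ho p hp, Matrix.mul_one, gram]

variable [Fintype P] [DecidableEq P] [Fintype ι]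

/-- The product vector whose factor at `p` is the combination of the columns of `V p` with
coefficients `c p`. -/
def columnProduct (V : ∀ p, Matrix (σ p) ι ℂ) (c : P → ι → ℂ) : StateVec σ :=
  productVec fun p => WithLp.toLp 2 (V p *ᵥ c p)

theorem recordProb_columnProduct (c : P → ι → ℂ) (h : List ℕ) :
    π.recordProb (columnProduct V c) h = ∏ p, (matrixForm (π.gram V p h) (c p) (c p)).re := by
  rw [recordProb, columnProduct, applyLocal_productVec, norm_productVec, ← Finset.prod_pow]
  refine Finset.prod_congr rfl fun p _ => ?_
  rw [gram, matrixForm_self_re, mulVec_mulVec]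

/-- Conservation of probability: in each round only the actor's factor of the product changes, and
its values over the outcomes add up to the old one. -/
theorem sum_recordProb_columnProduct [DecidableEq ι] (hV : ∀ p, (V p)ᴴ * V p = 1)
    (c : P → ι → ℂ) (n : ℕ) :
    ∑ h ∈ π.records n, π.recordProb (columnProduct V c) h = ∏ p, (star (c p) ⬝ᵥ c p).re := by
  induction n with
  | zero =>
    simp [records, recordProb_columnProduct, gram_nil π V hV, matrixForm]
  | succ n ih =>
    rw [sum_records_succ, ← ih]
    refine Finset.sum_congr rfl fun h _ => ?_
    simp only [recordProb_columnProduct]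
    rw [← Finset.mul_prod_erase _ _ (Finset.mem_univ (π.actor h)), ← sum_gram_actor,
      matrixForm_sum, Complex.re_sum, Finset.sum_mul]
    refine Finset.sum_congr rfl fun o ho => ?_
    rw [← Finset.mul_prod_erase _ _ (Finset.mem_univ (π.actor h))]
    congr 1
    refine Finset.prod_congr rfl fun p hp => ?_
    rw [gram_cons_of_ne_actor π V (Finset.mem_range.1 ho) (Finset.ne_of_mem_erase hp)]

open Filter Topology in
/-- If two different states are recognized with probability tending to `1`, then the
Bhattacharyya overlap of their record distributions tends to `0`. -/
theorem tendsto_overlap {π : LOCCProtocol P σ} {guess : List ℕ → StateVec σ} {ψ φ : StateVec σ}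
    (hne : ψ ≠ φ) (hψ : ∀ n, ∑ h ∈ π.records n, π.recordProb ψ h = 1)
    (hφ : ∀ n, ∑ h ∈ π.records n, π.recordProb φ h = 1)
    (tψ : Tendsto (fun n => π.successProb guess n ψ) atTop (𝓝 1))
    (tφ : Tendsto (fun n => π.successProb guess n φ) atTop (𝓝 1)) :
    Tendsto (fun n => ∑ h ∈ π.records n, √(π.recordProb ψ h) * √(π.recordProb φ h))
      atTop (𝓝 0) := by
  classical
  have nn : ∀ χ h, 0 ≤ π.recordProb χ h := fun χ h => sq_nonneg _
  have fail : ∀ χ, (∀ n, ∑ h ∈ π.records n, π.recordProb χ h = 1) → ∀ n,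
      ∑ h ∈ (π.records n).filter (fun h => ¬ guess h = χ), π.recordProb χ h
        = 1 - π.successProb guess n χ := by
    intro χ hχ n
    have h1 := Finset.sum_filter_add_sum_filter_not (π.records n) (fun h => guess h = χ)
      (π.recordProb χ)
    rw [hχ] at h1
    have h2 : π.successProb guess n χ
        = ∑ h ∈ (π.records n).filter (fun h => guess h = χ), π.recordProb χ h := by
      rw [successProb]
    linarith
  -- Cauchy–Schwarz on the records where the guess misses `χ`: the mass of `χ` there is the failure
  -- probability, that of `ξ` is at most 1.
  have part : ∀ χ ξ, (∀ n, ∑ h ∈ π.records n, π.recordProb χ h = 1) →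
      (∀ n, ∑ h ∈ π.records n, π.recordProb ξ h = 1) → ∀ n,
      ∑ h ∈ (π.records n).filter (fun h => ¬ guess h = χ),
        √(π.recordProb χ h) * √(π.recordProb ξ h) ≤ √(1 - π.successProb guess n χ) := by
    intro χ ξ hχ hξ n
    refine (Real.sum_sqrt_mul_sqrt_le _ (nn χ) (nn ξ)).trans ?_
    rw [fail χ hχ n]
    refine mul_le_of_le_one_right (Real.sqrt_nonneg _) (Real.sqrt_le_one.2 ?_)
    rw [← hξ n]
    exact Finset.sum_le_sum_of_subset_of_nonneg (Finset.filter_subset _ _) fun h _ _ => nn ξ h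
  have lim : ∀ χ, Tendsto (fun n => π.successProb guess n χ) atTop (𝓝 1) →
      Tendsto (fun n => √(1 - π.successProb guess n χ)) atTop (𝓝 0) := by
    intro χ t
    simpa using (t.const_sub 1).sqrt
  refine squeeze_zero (fun n => Finset.sum_nonneg fun h _ => by positivity) (fun n => ?_)
    (by simpa using (lim ψ tψ).add (lim φ tφ))
  refine le_trans ?_ (add_le_add (part ψ φ hψ hφ n) (part φ ψ hφ hψ n))
  rw [Finset.sum_filter, Finset.sum_filter, ← Finset.sum_add_distrib]
  refine Finset.sum_le_sum fun h _ => ?_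
  -- A record cannot be guessed as both `ψ` and `φ`, so it occurs in at least one of the two sums.
  by_cases hg : guess h = ψ
  · simp [hg, hne, mul_comm]
  · have : 0 ≤ (if ¬ guess h = φ then √(π.recordProb φ h) * √(π.recordProb ψ h) else 0) := by
      positivity
    rw [if_pos hg]
    linarith

end LOCCProtocol

/-! ### Domino states and a potential on pairs of Gram matrices -/

namespace Domino

/-- Coefficients of the first factors of the eight domino states `|0⟩|0±1⟩`, `|0±1⟩|2⟩`,
`|2⟩|1±2⟩`, `|1±2⟩|0⟩`. -/
def leftInt (i : Fin 4 × Fin 2) : Fin 3 → ℤ :=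
  ![![1, 0, 0], ![1, (-1) ^ (i.2 : ℕ), 0], ![0, 0, 1], ![0, 1, (-1) ^ (i.2 : ℕ)]] i.1

/-- Coefficients of the second factors of the eight domino states. -/
def rightInt (i : Fin 4 × Fin 2) : Fin 3 → ℤ :=
  ![![1, (-1) ^ (i.2 : ℕ), 0], ![0, 0, 1], ![0, 1, (-1) ^ (i.2 : ℕ)], ![1, 0, 0]] i.1

def left (i : Fin 4 × Fin 2) (k : Fin 3) : ℂ := leftInt i k
def right (i : Fin 4 × Fin 2) (k : Fin 3) : ℂ := rightInt i k

theorem dotProduct_eq (i j : Fin 4 × Fin 2) :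
    (star (left i) ⬝ᵥ left j) * (star (right i) ⬝ᵥ right j) = if i = j then 2 else 0 := by
  have key : ∀ i j : Fin 4 × Fin 2, (∑ k, leftInt i k * leftInt j k) *
      (∑ k, rightInt i k * rightInt j k) = if i = j then 2 else 0 := by decide +kernel
  have := congrArg (Int.cast : ℤ → ℂ) (key i j)
  simpa [dotProduct, left, right, apply_ite (Int.cast : ℤ → ℂ)] using this

/-- The matrix is, up to a relative error of `1/30`, a multiple of the identity. The conditions are
those that preservation of the orthogonality of the domino states imposes. -/
structure NearScalar (G : Matrix (Fin 3) (Fin 3) ℂ) : Prop where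
  row_zero_add : ‖G 0 1 + G 0 2‖ ≤ G.trace.re / 30
  row_zero_sub : ‖G 0 1 - G 0 2‖ ≤ G.trace.re / 30
  row_two_add : ‖G 2 0 + G 2 1‖ ≤ G.trace.re / 30
  row_two_sub : ‖G 2 0 - G 2 1‖ ≤ G.trace.re / 30
  diag_zero_one : ‖G 0 0 - G 0 1 + G 1 0 - G 1 1‖ ≤ G.trace.re / 30
  diag_one_two : ‖G 1 1 - G 1 2 + G 2 1 - G 2 2‖ ≤ G.trace.re / 30

theorem nearScalar_one : NearScalar 1 := by
  constructor <;> simp <;> norm_num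

theorem trace_re_nonneg {G : Matrix (Fin 3) (Fin 3) ℂ} (hG : G.PosSemidef) :
    0 ≤ G.trace.re := (Complex.le_def.1 hG.trace_nonneg).1

theorem norm_le_of_add_of_sub {x y : ℂ} {t : ℝ} (h₁ : ‖x + y‖ ≤ t) (h₂ : ‖x - y‖ ≤ t) :
    ‖x‖ ≤ t ∧ ‖y‖ ≤ t := by
  constructor
  · have := norm_add_le (x + y) (x - y)
    rw [show x + y + (x - y) = 2 * x by ring, norm_mul, Complex.norm_ofNat] at this
    linarith
  · have := norm_sub_le (x + y) (x - y)
    rw [show x + y - (x - y) = 2 * y by ring, norm_mul, Complex.norm_ofNat] at this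
    linarith

namespace NearScalar

variable {G : Matrix (Fin 3) (Fin 3) ℂ}

theorem norm_offDiag_le (h : NearScalar G) (hG : G.PosSemidef) :
    ‖G 0 1‖ ≤ G.trace.re / 30 ∧ ‖G 1 0‖ ≤ G.trace.re / 30 ∧
      ‖G 1 2‖ ≤ G.trace.re / 30 ∧ ‖G 2 1‖ ≤ G.trace.re / 30 := by
  have h1 := (norm_le_of_add_of_sub h.row_zero_add h.row_zero_sub).1
  have h2 := (norm_le_of_add_of_sub h.row_two_add h.row_two_sub).2
  refine ⟨h1, ?_, ?_, h2⟩
  · rwa [← hG.isHermitian.apply 1 0, norm_star]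
  · rwa [← hG.isHermitian.apply 1 2, norm_star]

/-- For Hermitian `G` the off-diagonal terms cancel in the real parts of the last two conditions, so
neighbouring diagonal entries differ by at most `tr G / 30`. As the three add up to the trace, each
is at least `(1 - 3/30)/3 = 3/10` of it. -/
theorem le_diag (h : NearScalar G) (hG : G.PosSemidef) (k : Fin 3) :
    G.trace.re / 4 ≤ (G k k).re := by
  have h1 := (Complex.abs_re_le_norm _).trans h.diag_zero_one
  have h2 := (Complex.abs_re_le_norm _).trans h.diag_one_two
  have e1 : (G 1 0).re = (G 0 1).re := by
    rw [← hG.isHermitian.apply 1 0]; rfl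
  have e2 : (G 2 1).re = (G 1 2).re := by
    rw [← hG.isHermitian.apply 2 1]; rfl
  have t : G.trace.re = (G 0 0).re + (G 1 1).re + (G 2 2).re := by
    simp [Matrix.trace_fin_three]
  have := trace_re_nonneg hG
  simp only [Complex.add_re, Complex.sub_re, e1, e2, abs_le] at h1 h2
  fin_cases k <;> simp <;> linarith

theorem le_norm_diag (h : NearScalar G) (hG : G.PosSemidef) (k : Fin 3) :
    G.trace.re / 6 ≤ ‖G k k‖ := by
  have := h.le_diag hG k
  have := Complex.re_le_norm (G k k)
  have := trace_re_nonneg hG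
  linarith

/-- `1/4 - 1/30 ≥ 1/6`. This `6` and the `30` of `NearScalar` make up the constant `180`. -/
theorem le_norm_diag_add (h : NearScalar G) (hG : G.PosSemidef) (k : Fin 3) {z : ℂ}
    (hz : ‖z‖ ≤ G.trace.re / 30) : G.trace.re / 6 ≤ ‖G k k + z‖ := by
  have := h.le_diag hG k
  have := Complex.re_le_norm (G k k)
  have := trace_re_nonneg hG
  have := norm_sub_le (G k k + z) z
  rw [add_sub_cancel_right] at this
  linarith

end NearScalar

/-- The total size of the overlaps of different domino states after the local operations with Gram
matrices `E` and `F`. -/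
def overlap (E F : Matrix (Fin 3) (Fin 3) ℂ) : ℝ :=
  ∑ x ∈ (Finset.univ : Finset (Fin 4 × Fin 2)).offDiag,
    ‖matrixForm E (left x.1) (left x.2)‖ * ‖matrixForm F (right x.1) (right x.2)‖

/-- The unnormalized probability of the domino state `i`. -/
def prob (E F : Matrix (Fin 3) (Fin 3) ℂ) (i : Fin 4 × Fin 2) : ℝ :=
  (matrixForm E (left i) (left i)).re * (matrixForm F (right i) (right i)).re

open Classical in
/-- A function of the Gram matrices whose sum over the records does not decrease
as a protocol proceeds. -/
def potential (E F : Matrix (Fin 3) (Fin 3) ℂ) : ℝ :=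
  max (overlap E F)
    (if NearScalar E ∧ NearScalar F then E.trace.re * F.trace.re / 180 else 0)

theorem overlap_nonneg (E F : Matrix (Fin 3) (Fin 3) ℂ) : 0 ≤ overlap E F :=
  Finset.sum_nonneg fun _ _ => by positivity

theorem potential_nonneg (E F : Matrix (Fin 3) (Fin 3) ℂ) : 0 ≤ potential E F :=
  (overlap_nonneg E F).trans (le_max_left _ _)

theorem le_overlap (E F : Matrix (Fin 3) (Fin 3) ℂ) {i j : Fin 4 × Fin 2} (hij : i ≠ j)
    {x y : ℂ} (hx : matrixForm E (left i) (left j) = x)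
    (hy : matrixForm F (right i) (right j) = y) {s t : ℝ} (ht : 0 ≤ t) (hsx : s ≤ ‖x‖)
    (hty : t ≤ ‖y‖) : s * t ≤ overlap E F := by
  refine (mul_le_mul hsx hty ht (norm_nonneg x)).trans ?_
  rw [← hx, ← hy]
  exact Finset.single_le_sum
    (f := fun x : (Fin 4 × Fin 2) × (Fin 4 × Fin 2) =>
      ‖matrixForm E (left x.1) (left x.2)‖ * ‖matrixForm F (right x.1) (right x.2)‖)
    (a := (i, j)) (fun _ _ => by positivity)
    (Finset.mem_offDiag.2 ⟨Finset.mem_univ i, Finset.mem_univ j, hij⟩)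

/-- Each condition in `NearScalar E` bounds the first factor of the overlap of some pair of domino
states whose second factor is a diagonal entry of `F`, possibly plus an off-diagonal one, hence at
least `tr F / 6`. A violated condition makes that overlap large. -/
theorem le_overlap_of_right_nearScalar {E F : Matrix (Fin 3) (Fin 3) ℂ} (hF : F.PosSemidef)
    (nF : NearScalar F) (nE : ¬ NearScalar E) :
    E.trace.re * F.trace.re / 180 ≤ overlap E F := by
  have tF : 0 ≤ F.trace.re / 6 := by have := trace_re_nonneg hF; positivity
  obtain ⟨-, b10, b12, -⟩ := nF.norm_offDiag_le hF
  rw [show E.trace.re * F.trace.re / 180 = E.trace.re / 30 * (F.trace.re / 6) by ring]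
  by_contra hlt
  refine nE ⟨?_, ?_, ?_, ?_, ?_, ?_⟩ <;> refine le_of_not_gt fun hgt => hlt ?_
  -- Row conditions come from tiles of different families with non-orthogonal second factors,
  -- diagonal conditions from the two signs within one tile.
  · refine le_overlap E F (i := (0, 0)) (j := (3, 0)) (by decide) (y := F 0 0 + F 1 0)
      ?_ ?_ tF hgt.le (nF.le_norm_diag_add hF 0 b10) <;>
    simp [matrixForm, left, right, leftInt, rightInt, dotProduct, mulVec, Fin.sum_univ_three]
  · refine le_overlap E F (i := (0, 0)) (j := (3, 1)) (by decide) (y := F 0 0 + F 1 0)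
      ?_ ?_ tF hgt.le (nF.le_norm_diag_add hF 0 b10) <;>
    simp [matrixForm, left, right, leftInt, rightInt, dotProduct, mulVec, Fin.sum_univ_three,
      sub_eq_add_neg]
  · refine le_overlap E F (i := (2, 0)) (j := (1, 0)) (by decide) (y := F 2 2 + F 1 2)
      ?_ ?_ tF hgt.le (nF.le_norm_diag_add hF 2 b12) <;>
    simp [matrixForm, left, right, leftInt, rightInt, dotProduct, mulVec, Fin.sum_univ_three,
      add_comm]
  · refine le_overlap E F (i := (2, 0)) (j := (1, 1)) (by decide) (y := F 2 2 + F 1 2)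
      ?_ ?_ tF hgt.le (nF.le_norm_diag_add hF 2 b12) <;>
    simp [matrixForm, left, right, leftInt, rightInt, dotProduct, mulVec, Fin.sum_univ_three,
      sub_eq_add_neg, add_comm]
  · refine le_overlap E F (i := (1, 0)) (j := (1, 1)) (by decide) (y := F 2 2)
      ?_ ?_ tF hgt.le (nF.le_norm_diag hF 2) <;>
    simp [matrixForm, left, right, leftInt, rightInt, dotProduct, mulVec, Fin.sum_univ_three]
    ring
  · refine le_overlap E F (i := (3, 0)) (j := (3, 1)) (by decide) (y := F 0 0)
      ?_ ?_ tF hgt.le (nF.le_norm_diag hF 0) <;>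
    simp [matrixForm, left, right, leftInt, rightInt, dotProduct, mulVec, Fin.sum_univ_three]
    ring

theorem le_overlap_of_left_nearScalar {E F : Matrix (Fin 3) (Fin 3) ℂ} (hE : E.PosSemidef)
    (hF : F.PosSemidef) (nE : NearScalar E) (nF : ¬ NearScalar F) :
    E.trace.re * F.trace.re / 180 ≤ overlap E F := by
  have tF : 0 ≤ F.trace.re / 30 := by have := trace_re_nonneg hF; positivity
  obtain ⟨-, b10, b12, -⟩ := nE.norm_offDiag_le hE
  rw [show E.trace.re * F.trace.re / 180 = E.trace.re / 6 * (F.trace.re / 30) by ring]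
  by_contra hlt
  refine nF ⟨?_, ?_, ?_, ?_, ?_, ?_⟩ <;> refine le_of_not_gt fun hgt => hlt ?_
  · refine le_overlap E F (i := (3, 0)) (j := (2, 0)) (by decide) (x := E 2 2 + E 1 2)
      ?_ ?_ tF (nE.le_norm_diag_add hE 2 b12) hgt.le <;>
    simp [matrixForm, left, right, leftInt, rightInt, dotProduct, mulVec, Fin.sum_univ_three,
      add_comm]
  · refine le_overlap E F (i := (3, 0)) (j := (2, 1)) (by decide) (x := E 2 2 + E 1 2)
      ?_ ?_ tF (nE.le_norm_diag_add hE 2 b12) hgt.le <;>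
    simp [matrixForm, left, right, leftInt, rightInt, dotProduct, mulVec, Fin.sum_univ_three,
      add_comm, sub_eq_add_neg]
  · refine le_overlap E F (i := (1, 0)) (j := (0, 0)) (by decide) (x := E 0 0 + E 1 0)
      ?_ ?_ tF (nE.le_norm_diag_add hE 0 b10) hgt.le <;>
    simp [matrixForm, left, right, leftInt, rightInt, dotProduct, mulVec, Fin.sum_univ_three]
  · refine le_overlap E F (i := (1, 0)) (j := (0, 1)) (by decide) (x := E 0 0 + E 1 0)
      ?_ ?_ tF (nE.le_norm_diag_add hE 0 b10) hgt.le <;>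
    simp [matrixForm, left, right, leftInt, rightInt, dotProduct, mulVec, Fin.sum_univ_three,
      sub_eq_add_neg]
  · refine le_overlap E F (i := (0, 0)) (j := (0, 1)) (by decide) (x := E 0 0)
      ?_ ?_ tF (nE.le_norm_diag hE 0) hgt.le <;>
    simp [matrixForm, left, right, leftInt, rightInt, dotProduct, mulVec, Fin.sum_univ_three]
    ring
  · refine le_overlap E F (i := (2, 0)) (j := (2, 1)) (by decide) (x := E 2 2)
      ?_ ?_ tF (nE.le_norm_diag hE 2) hgt.le <;>
    simp [matrixForm, left, right, leftInt, rightInt, dotProduct, mulVec, Fin.sum_univ_three]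
    ring

/-- One nearly scalar matrix suffices: if the other is not nearly scalar, the overlap takes over. -/
theorem le_potential {E F : Matrix (Fin 3) (Fin 3) ℂ} (hE : E.PosSemidef) (hF : F.PosSemidef)
    (h : NearScalar E ∨ NearScalar F) : E.trace.re * F.trace.re / 180 ≤ potential E F := by
  by_cases nE : NearScalar E
  · by_cases nF : NearScalar F
    · rw [potential, if_pos ⟨nE, nF⟩]
      exact le_max_right _ _
    · exact (le_overlap_of_left_nearScalar hE hF nE nF).trans (le_max_left _ _)
  · exact (le_overlap_of_right_nearScalar hF (h.resolve_left nE) nE).trans (le_max_left _ _)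

theorem potential_one_one : 1 / 20 ≤ potential 1 1 := by
  refine le_trans ?_ (le_potential PosSemidef.one PosSemidef.one (Or.inl nearScalar_one))
  simp
  norm_num

/-- The overlap is subadditive in `E`. The other term is additive in `tr E`, and since `F` does not
change, `le_potential` applies to every outcome, whether or not `E o` is still nearly scalar. -/
theorem potential_sum_left_le {s : Finset ℕ} {E : ℕ → Matrix (Fin 3) (Fin 3) ℂ}
    {F : Matrix (Fin 3) (Fin 3) ℂ} (hE : ∀ o, (E o).PosSemidef) (hF : F.PosSemidef) :
    potential (∑ o ∈ s, E o) F ≤ ∑ o ∈ s, potential (E o) F := by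
  rw [potential]
  refine max_le ?_ ?_
  · refine le_trans ?_ (Finset.sum_le_sum fun o _ => le_max_left (overlap (E o) F) _)
    simp only [overlap]
    rw [Finset.sum_comm]
    refine Finset.sum_le_sum fun x _ => ?_
    rw [matrixForm_sum, ← Finset.sum_mul]
    exact mul_le_mul_of_nonneg_right (norm_sum_le _ _) (norm_nonneg _)
  · split_ifs with h
    · refine le_trans (le_of_eq ?_)
        (Finset.sum_le_sum fun o _ => le_potential (hE o) hF (Or.inr h.2))
      rw [trace_sum, Complex.re_sum, ← Finset.sum_div, Finset.sum_mul]
    · exact Finset.sum_nonneg fun o _ => potential_nonneg _ _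

theorem potential_sum_right_le {s : Finset ℕ} {E : Matrix (Fin 3) (Fin 3) ℂ}
    {F : ℕ → Matrix (Fin 3) (Fin 3) ℂ} (hE : E.PosSemidef) (hF : ∀ o, (F o).PosSemidef) :
    potential E (∑ o ∈ s, F o) ≤ ∑ o ∈ s, potential E (F o) := by
  rw [potential]
  refine max_le ?_ ?_
  · refine le_trans ?_ (Finset.sum_le_sum fun o _ => le_max_left (overlap E (F o)) _)
    simp only [overlap]
    rw [Finset.sum_comm]
    refine Finset.sum_le_sum fun x _ => ?_
    rw [matrixForm_sum, ← Finset.mul_sum]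
    exact mul_le_mul_of_nonneg_left (norm_sum_le _ _) (norm_nonneg _)
  · split_ifs with h
    · refine le_trans (le_of_eq ?_)
        (Finset.sum_le_sum fun o _ => le_potential hE (hF o) (Or.inl h.1))
      rw [trace_sum, Complex.re_sum, ← Finset.sum_div, Finset.mul_sum]
    · exact Finset.sum_nonneg fun o _ => potential_nonneg _ _

theorem le_prob_of_nearScalar {E F : Matrix (Fin 3) (Fin 3) ℂ} (hE : E.PosSemidef)
    (hF : F.PosSemidef) (nE : NearScalar E) (nF : NearScalar F) (s : Fin 2) :
    E.trace.re * F.trace.re / 180 ≤ prob E F (0, s) := by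
  have tE := trace_re_nonneg hE
  have tF := trace_re_nonneg hF
  have h1 := nE.le_diag hE 0
  have h2 := nF.le_diag hF 0
  have h3 := nF.le_diag hF 1
  obtain ⟨b01, b10, -, -⟩ := nF.norm_offDiag_le hF
  have b01 := abs_le.1 ((Complex.abs_re_le_norm _).trans b01)
  have b10 := abs_le.1 ((Complex.abs_re_le_norm _).trans b10)
  have hx : (matrixForm E (left (0, s)) (left (0, s))).re = (E 0 0).re := by
    simp [matrixForm, left, leftInt, dotProduct, mulVec, Fin.sum_univ_three]
  have hy : F.trace.re / 4 ≤ (matrixForm F (right (0, s)) (right (0, s))).re := by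
    fin_cases s <;>
    simp [matrixForm, right, rightInt, dotProduct, mulVec, Fin.sum_univ_three] <;> linarith
  rw [prob, hx]
  refine le_trans ?_ (mul_le_mul h1 hy (by positivity) (by linarith))
  nlinarith [mul_nonneg tE tF]

/-- Overlaps are bounded by Cauchy–Schwarz on both sides. In the nearly scalar case the two states
of the first tile alone are both likely enough to give the bound. -/
theorem potential_le {E F : Matrix (Fin 3) (Fin 3) ℂ} (hE : E.PosSemidef) (hF : F.PosSemidef) :
    potential E F ≤ ∑ x ∈ (Finset.univ : Finset (Fin 4 × Fin 2)).offDiag,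
      √(prob E F x.1) * √(prob E F x.2) := by
  rw [potential]
  refine max_le (Finset.sum_le_sum fun x _ => ?_) ?_
  · refine (mul_le_mul (norm_matrixForm_le hE _ _) (norm_matrixForm_le hF _ _)
      (norm_nonneg _) (by positivity)).trans (le_of_eq ?_)
    rw [prob, prob, Real.sqrt_mul (matrixForm_self_re_nonneg hE _),
      Real.sqrt_mul (matrixForm_self_re_nonneg hE _)]
    ring
  · split_ifs with h
    · have tE := trace_re_nonneg hE
      have tF := trace_re_nonneg hF
      refine le_trans ?_ (Finset.single_le_sum
        (f := fun x : (Fin 4 × Fin 2) × (Fin 4 × Fin 2) => √(prob E F x.1) * √(prob E F x.2))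
        (a := ((0, 0), (0, 1))) (fun _ _ => by positivity) (by simp))
      refine le_trans (le_of_eq ?_) (mul_le_mul
        (Real.sqrt_le_sqrt (le_prob_of_nearScalar hE hF h.1 h.2 0))
        (Real.sqrt_le_sqrt (le_prob_of_nearScalar hE hF h.1 h.2 1))
        (Real.sqrt_nonneg _) (Real.sqrt_nonneg _))
      rw [Real.mul_self_sqrt (by positivity)]
    · exact Finset.sum_nonneg fun _ _ => by positivity

end Domino

/-! ### Indistinguishability of the domino states -/

namespace LOCCProtocol

theorem recordProb_smul {P : Type} {σ : P → Type} [∀ p, Fintype (σ p)] [∀ p, DecidableEq (σ p)]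
    [Fintype P] [DecidableEq P] (π : LOCCProtocol P σ) (a : ℂ) (ψ : StateVec σ) (h : List ℕ) :
    π.recordProb (a • ψ) h = ‖a‖ ^ 2 * π.recordProb ψ h := by
  have : applyLocal (fun p => π.accumulated p h) (a • ψ)
      = a • applyLocal (fun p => π.accumulated p h) ψ := by
    ext j
    simp only [applyLocal, PiLp.smul_apply, smul_eq_mul, Finset.mul_sum]
    exact Finset.sum_congr rfl fun i _ => by ring
  rw [recordProb, recordProb, this, norm_smul, mul_pow]

end LOCCProtocol

namespace Domino

open LOCCProtocol

variable {τ : Bool → Type} [∀ p, Fintype (τ p)]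

/-- The coefficients of the factors of the domino state `i` if the party `q` holds
the first one. -/
def coeff (q : Bool) (i : Fin 4 × Fin 2) (p : Bool) : Fin 3 → ℂ :=
  if p = q then left i else right i

theorem inner_columnProduct {V : ∀ p, Matrix (τ p) (Fin 3) ℂ} (hV : ∀ p, (V p)ᴴ * V p = 1)
    (q : Bool) (i j : Fin 4 × Fin 2) :
    inner ℂ (columnProduct V (coeff q i)) (columnProduct V (coeff q j))
      = if i = j then 2 else 0 := by
  rw [columnProduct, columnProduct, inner_productVec, Fintype.prod_bool]
  simp only [← matrixForm_conjTranspose_mul_self, hV, matrixForm, one_mulVec]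
  rw [← dotProduct_eq]
  cases q <;> simp [coeff, mul_comm]

variable [∀ p, DecidableEq (τ p)]

theorem recordProb_eq_prob (π : LOCCProtocol Bool τ) (V : ∀ p, Matrix (τ p) (Fin 3) ℂ)
    (q : Bool) (i : Fin 4 × Fin 2) (h : List ℕ) :
    π.recordProb (columnProduct V (coeff q i)) h
      = prob (π.gram V q h) (π.gram V (!q) h) i := by
  rw [recordProb_columnProduct, prob, Fintype.prod_bool]
  cases q <;> simp [coeff, mul_comm]

/-- Whichever group acts, the potential is subadditive in its Gram matrix, so summing over the
outcomes of a round cannot lower the total. -/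
theorem le_sum_potential (π : LOCCProtocol Bool τ) {V : ∀ p, Matrix (τ p) (Fin 3) ℂ}
    (hV : ∀ p, (V p)ᴴ * V p = 1) (q : Bool) (n : ℕ) :
    1 / 20 ≤ ∑ h ∈ π.records n, potential (π.gram V q h) (π.gram V (!q) h) := by
  induction n with
  | zero => simpa [records, gram_nil π V hV] using potential_one_one
  | succ n ih =>
    rw [sum_records_succ]
    refine ih.trans (Finset.sum_le_sum fun h _ => ?_)
    by_cases hq : π.actor h = q
    · have hne : (!q) ≠ π.actor h := by simp [hq]
      conv_lhs => rw [← hq, ← sum_gram_actor, hq]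
      refine (potential_sum_left_le (fun o => π.gram_posSemidef V _ _)
        (π.gram_posSemidef V _ _)).trans (le_of_eq (Finset.sum_congr rfl fun o ho => ?_))
      rw [gram_cons_of_ne_actor π V (Finset.mem_range.1 ho) hne]
    · have hq' : π.actor h = !q := Bool.eq_not.2 hq
      conv_lhs => rw [← hq', ← sum_gram_actor, hq']
      refine (potential_sum_right_le (π.gram_posSemidef V _ _)
        (fun o => π.gram_posSemidef V _ _)).trans (le_of_eq (Finset.sum_congr rfl fun o ho => ?_))
      rw [gram_cons_of_ne_actor π V (Finset.mem_range.1 ho) (Ne.symm hq)]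

open Filter Topology in
/-- A set of bipartite states that contains the eight domino states, up to local isometries,
is not perfectly distinguishable by LOCC. -/
theorem not_loccDistinguishable {S : Set (StateVec τ)} {V : ∀ p, Matrix (τ p) (Fin 3) ℂ}
    (hV : ∀ p, (V p)ᴴ * V p = 1) (q : Bool)
    (hS : ∀ i, ((1 / √2 : ℝ) : ℂ) • columnProduct V (coeff q i) ∈ S) :
    ¬ LOCCDistinguishable S := by
  rintro ⟨π, guess, hπ⟩
  have hhalf : ‖((1 / √2 : ℝ) : ℂ)‖ ^ 2 = 1 / 2 := by
    rw [Complex.norm_real, Real.norm_eq_abs, sq_abs, div_pow, Real.sq_sqrt zero_le_two, one_pow]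
  have hprob : ∀ i h, π.recordProb (((1 / √2 : ℝ) : ℂ) • columnProduct V (coeff q i)) h
      = 1 / 2 * prob (π.gram V q h) (π.gram V (!q) h) i := fun i h => by
    rw [recordProb_smul, hhalf, recordProb_eq_prob]
  have htotal : ∀ i n, ∑ h ∈ π.records n,
      π.recordProb (((1 / √2 : ℝ) : ℂ) • columnProduct V (coeff q i)) h = 1 := fun i n => by
    have hn : ‖columnProduct V (coeff q i)‖ ^ 2 = 2 := by
      rw [norm_sq_eq_re_inner (𝕜 := ℂ), inner_columnProduct hV, if_pos rfl]
      simp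
    have hs : ∏ p, (star (coeff q i p) ⬝ᵥ coeff q i p).re = ‖columnProduct V (coeff q i)‖ ^ 2 := by
      rw [columnProduct, norm_productVec, ← Finset.prod_pow]
      refine Finset.prod_congr rfl fun p _ => ?_
      rw [← matrixForm_self_re, hV, matrixForm, one_mulVec]
    simp only [recordProb_smul, hhalf]
    rw [← Finset.mul_sum, sum_recordProb_columnProduct π V hV, hs, hn]
    norm_num
  have hne : ∀ i j, i ≠ j → ((1 / √2 : ℝ) : ℂ) • columnProduct V (coeff q i)
      ≠ ((1 / √2 : ℝ) : ℂ) • columnProduct V (coeff q j) := by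
    intro i j hij he
    have h0 : ((1 / √2 : ℝ) : ℂ) ≠ 0 := by simp
    have he := smul_right_injective _ h0 he
    have h1 := inner_columnProduct hV q i i
    have h2 := inner_columnProduct hV q i j
    rw [← he, h1, if_pos rfl, if_neg hij] at h2
    exact two_ne_zero h2
  -- The factor 2 undoes the normalization: the unnormalized domino states have squared norm 2.
  have hlim : Tendsto (fun n => ∑ x ∈ (Finset.univ : Finset (Fin 4 × Fin 2)).offDiag,
      2 * ∑ h ∈ π.records n,
        √(π.recordProb (((1 / √2 : ℝ) : ℂ) • columnProduct V (coeff q x.1)) h) *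
        √(π.recordProb (((1 / √2 : ℝ) : ℂ) • columnProduct V (coeff q x.2)) h))
      atTop (𝓝 0) := by
    have hzero := Finset.sum_const_zero (ι := (Fin 4 × Fin 2) × (Fin 4 × Fin 2)) (M := ℝ)
      (s := Finset.univ.offDiag)
    refine (tendsto_finsetSum _ fun x hx => ?_).trans (congrArg 𝓝 hzero).le
    simpa using (tendsto_overlap (hne x.1 x.2 (Finset.mem_offDiag.1 hx).2.2) (htotal _)
      (htotal _) (hπ _ (hS _)) (hπ _ (hS _))).const_mul 2
  have hle : (1 / 20 : ℝ) ≤ 0 := by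
    refine ge_of_tendsto hlim (Eventually.of_forall fun n => ?_)
    refine (le_sum_potential π hV q n).trans ((Finset.sum_le_sum fun h _ => potential_le
      (π.gram_posSemidef V _ h) (π.gram_posSemidef V _ h)).trans (le_of_eq ?_))
    rw [Finset.sum_comm]
    refine Finset.sum_congr rfl fun x _ => ?_
    rw [Finset.mul_sum]
    refine Finset.sum_congr rfl fun h _ => ?_
    rw [hprob, hprob, Real.sqrt_mul (by norm_num), Real.sqrt_mul (by norm_num),
      mul_mul_mul_comm, Real.mul_self_sqrt (by norm_num)]
    ring
  norm_num at hle

end Domino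

theorem groupParties_productVec {P Q : Type} [Fintype P] [DecidableEq P] [Fintype Q]
    [DecidableEq Q] {σ : P → Type} [∀ p, Fintype (σ p)] (f : P → Q)
    (φ : ∀ p, EuclideanSpace ℂ (σ p)) :
    groupParties f (productVec φ)
      = productVec fun q => productVec fun i : {i : P // f i = q} => φ i := by
  ext x
  simp only [groupParties, productVec]
  rw [← Fintype.prod_fiberwise f]
  refine Finset.prod_congr rfl fun q _ => Finset.prod_congr rfl ?_
  rintro ⟨i, rfl⟩ _
  rfl

/-! ### Integer coordinates and orthogonality of `Σ` -/

namespace SigmaStates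

/-- The local vector with integer coefficient `c l` at the basis vector with label `l`. -/
def ofInt (c : ℕ → ℤ) : LocalVec := fun p =>
  WithLp.toLp 2 fun i => (c (firstLabel p + i) : ℂ)

theorem inner_ofInt (c d : ℕ → ℤ) (p : Fin 3) :
    inner ℂ (ofInt c p) (ofInt d p)
      = ((∑ i : Fin (dims p), c (firstLabel p + i) * d (firstLabel p + i) : ℤ) : ℂ) := by
  simp [ofInt, PiLp.inner_apply, mul_comm]

def ketInt (l : ℕ) (n : ℕ) : ℤ := if n = l then 1 else 0

theorem ket_eq_ofInt (l : ℕ) : ket l = ofInt (ketInt l) := by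
  funext p
  ext i
  simp [ket, ofInt, ketInt]

def pairInt (a b : ℕ) (s : Fin 2) (n : ℕ) : ℤ := ketInt a n + (-1) ^ (s : ℕ) * ketInt b n

theorem pair_eq_ofInt (a b : ℕ) (s : Fin 2) (p : Fin 3) :
    pair a b s p = ((1 / √2 : ℝ) : ℂ) • ofInt (pairInt a b s) p := by
  ext i
  simp [pair, ket_eq_ofInt, ofInt, pairInt, mul_add]

/-- The parity condition is built in: the third sign exponent is `i + j` modulo 2. -/
def quadInt (a b c d : ℕ) (i j : Fin 2) (n : ℕ) : ℤ :=
  ketInt a n + (-1) ^ (i : ℕ) * ketInt b n + (-1) ^ (j : ℕ) * ketInt c n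
    + (-1) ^ ((i + j : Fin 2) : ℕ) * ketInt d n

theorem quad_eq_ofInt (a b c d : ℕ) (i j : Fin 2) (p : Fin 3) :
    quad a b c d i j (i + j) p = (1 / 2 : ℂ) • ofInt (quadInt a b c d i j) p := by
  ext k
  simp [quad, ket_eq_ofInt, ofInt, quadInt, mul_add]

/-- Labels of the states of `Σ`: families of two and of four states. -/
abbrev Index : Type := (Fin 7 × Fin 2) ⊕ (Fin 7 × Fin 2 × Fin 2)

/-- The integer coefficients of the factors of the states of `Σ`, up to normalization. -/
def factorInt : Index → Fin 3 → ℕ → ℤ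
  | .inl (t, s) =>
    ![![ketInt 1, pairInt 1 2 s, ketInt 4],
      ![pairInt 1 2 s, ketInt 3, ketInt 4],
      ![ketInt 3, pairInt 2 3 s, ketInt 4],
      ![pairInt 2 3 s, ketInt 1, ketInt 4],
      ![ketInt 4, ketInt 3, pairInt 2 4 s],
      ![pairInt 2 4 s, ketInt 3, ketInt 1],
      ![ketInt 1, ketInt 3, pairInt 1 2 s]] t
  | .inr (t, i, j) =>
    ![![ketInt 0, quadInt 0 1 2 3 i j, ketInt 3],
      ![quadInt 0 1 2 3 i j, ketInt 4, ketInt 3],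
      ![ketInt 4, quadInt 1 2 3 4 i j, ketInt 3],
      ![quadInt 1 2 3 4 i j, ketInt 0, ketInt 3],
      ![ketInt 5, ketInt 0, quadInt 1 2 3 4 i j],
      ![quadInt 1 2 4 5 i j, ketInt 0, ketInt 5],
      ![ketInt 3, ketInt 0, quadInt 1 2 4 5 i j]] t

/-- The normalization factors of the states of `Σ`. -/
def scale : Index → ℂ
  | .inl _ => ((1 / √2 : ℝ) : ℂ)
  | .inr _ => 1 / 2

/-- The state of `Σ` with a given label. -/
def state (t : Index) : StateVec fun p : Fin 3 => Fin (dims p) :=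
  scale t • productVec fun p => ofInt (factorInt t p) p

theorem tri_apply (a b c : LocalVec) (x : ∀ p : Fin 3, Fin (dims p)) :
    tri a b c x = a 0 (x 0) * b 1 (x 1) * c 2 (x 2) := by
  simp only [tri, productVec, Fin.prod_univ_three]
  rfl

theorem tri_eq_state {t : Index} {a b c : LocalVec} {r₀ r₁ r₂ : ℂ}
    (ha : a 0 = r₀ • ofInt (factorInt t 0) 0) (hb : b 1 = r₁ • ofInt (factorInt t 1) 1)
    (hc : c 2 = r₂ • ofInt (factorInt t 2) 2) (hr : r₀ * r₁ * r₂ = scale t) :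
    tri a b c = state t := by
  ext x
  rw [tri_apply, ha, hb, hc, state, ← hr]
  simp only [PiLp.smul_apply, productVec, Fin.prod_univ_three, smul_eq_mul]
  ring

theorem ket_eq_smul_ofInt (l : ℕ) (p : Fin 3) : ket l p = (1 : ℂ) • ofInt (ketInt l) p := by
  rw [one_smul, ket_eq_ofInt]

theorem exists_eq_state {ψ : StateVec fun p : Fin 3 => Fin (dims p)} (hψ : ψ ∈ SigmaSet) :
    ∃ t, ψ = state t := by
  rcases hψ with ⟨s, h⟩ | ⟨i, j, k, hk, h⟩
  · rcases h with rfl | rfl | rfl | rfl | rfl | rfl | rfl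
    · exact ⟨.inl (0, s), tri_eq_state (ket_eq_smul_ofInt _ _)
        (pair_eq_ofInt _ _ _ _) (ket_eq_smul_ofInt _ _) (by simp [scale])⟩
    · exact ⟨.inl (1, s), tri_eq_state (pair_eq_ofInt _ _ _ _)
        (ket_eq_smul_ofInt _ _) (ket_eq_smul_ofInt _ _) (by simp [scale])⟩
    · exact ⟨.inl (2, s), tri_eq_state (ket_eq_smul_ofInt _ _)
        (pair_eq_ofInt _ _ _ _) (ket_eq_smul_ofInt _ _) (by simp [scale])⟩
    · exact ⟨.inl (3, s), tri_eq_state (pair_eq_ofInt _ _ _ _)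
        (ket_eq_smul_ofInt _ _) (ket_eq_smul_ofInt _ _) (by simp [scale])⟩
    · exact ⟨.inl (4, s), tri_eq_state (ket_eq_smul_ofInt _ _)
        (ket_eq_smul_ofInt _ _) (pair_eq_ofInt _ _ _ _) (by simp [scale])⟩
    · exact ⟨.inl (5, s), tri_eq_state (pair_eq_ofInt _ _ _ _)
        (ket_eq_smul_ofInt _ _) (ket_eq_smul_ofInt _ _) (by simp [scale])⟩
    · exact ⟨.inl (6, s), tri_eq_state (ket_eq_smul_ofInt _ _)
        (ket_eq_smul_ofInt _ _) (pair_eq_ofInt _ _ _ _) (by simp [scale])⟩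
  · have sum_eq_zero : ∀ i j k : Fin 2, i + j + k = 0 → k = i + j := by decide
    obtain rfl := sum_eq_zero i j k hk
    rcases h with rfl | rfl | rfl | rfl | rfl | rfl | rfl
    · exact ⟨.inr (0, i, j), tri_eq_state (ket_eq_smul_ofInt _ _)
        (quad_eq_ofInt _ _ _ _ _ _ _) (ket_eq_smul_ofInt _ _) (by simp [scale])⟩
    · exact ⟨.inr (1, i, j), tri_eq_state (quad_eq_ofInt _ _ _ _ _ _ _)
        (ket_eq_smul_ofInt _ _) (ket_eq_smul_ofInt _ _) (by simp [scale])⟩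
    · exact ⟨.inr (2, i, j), tri_eq_state (ket_eq_smul_ofInt _ _)
        (quad_eq_ofInt _ _ _ _ _ _ _) (ket_eq_smul_ofInt _ _) (by simp [scale])⟩
    · exact ⟨.inr (3, i, j), tri_eq_state (quad_eq_ofInt _ _ _ _ _ _ _)
        (ket_eq_smul_ofInt _ _) (ket_eq_smul_ofInt _ _) (by simp [scale])⟩
    · exact ⟨.inr (4, i, j), tri_eq_state (ket_eq_smul_ofInt _ _)
        (ket_eq_smul_ofInt _ _) (quad_eq_ofInt _ _ _ _ _ _ _) (by simp [scale])⟩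
    · exact ⟨.inr (5, i, j), tri_eq_state (quad_eq_ofInt _ _ _ _ _ _ _)
        (ket_eq_smul_ofInt _ _) (ket_eq_smul_ofInt _ _) (by simp [scale])⟩
    · exact ⟨.inr (6, i, j), tri_eq_state (ket_eq_smul_ofInt _ _)
        (ket_eq_smul_ofInt _ _) (quad_eq_ofInt _ _ _ _ _ _ _) (by simp [scale])⟩

/-- The squared norms of the unnormalized states of `Σ`. -/
def sqNormInt : Index → ℤ
  | .inl _ => 2
  | .inr _ => 4

/-- With the normalizations stripped off, all 42 × 42 inner products are integers, so the Gram
matrix is decided by evaluation. -/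
theorem prod_factorInt (t u : Index) :
    ∏ p, ∑ i : Fin (dims p), factorInt t p (firstLabel p + i) * factorInt u p (firstLabel p + i)
      = if t = u then sqNormInt t else 0 := by
  revert t u
  decide +kernel

theorem inner_state (t u : Index) : inner ℂ (state t) (state u) = if t = u then 1 else 0 := by
  rw [state, state, inner_smul_left, inner_smul_right, inner_productVec]
  simp only [inner_ofInt]
  rw [← Int.cast_prod, prod_factorInt]
  split_ifs with h
  · subst h
    rcases t with t | t
    · simp only [scale, sqNormInt, Complex.conj_ofReal]
      norm_cast
      field_simp
      norm_num
    · norm_num [scale, sqNormInt, Complex.conj_ofNat]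
  · simp

/-! ### Domino subspaces across a bipartition -/

section Grouping

variable (f : Fin 3 → Bool) (label : Fin 3 → ℕ) (rest : Fin 3) (fixed : ℕ)

/-- The label of party `i` in the `k`-th basis vector of the subspace that the domino states span:
the party `rest` is always in the basis state `fixed`. -/
def dominoLabel (i k : Fin 3) : ℕ := if i = rest then fixed else label k

/-- The isometry from `ℂ³` onto the subspace of group `q` that the domino states use. -/
def dominoIsometry (q : Bool) :
    Matrix (∀ i : {i : Fin 3 // f i = q}, Fin (dims i)) (Fin 3) ℂ :=
  Matrix.of fun x k => ∏ i : {i : Fin 3 // f i = q},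
    ket (dominoLabel label rest fixed i k) i (x i)

theorem inner_ket {a : ℕ} (b : ℕ) {p : Fin 3} (h₁ : firstLabel p ≤ a)
    (h₂ : a < firstLabel p + dims p) :
    inner ℂ (ket a p) (ket b p) = if a = b then 1 else 0 := by
  rw [ket_eq_ofInt, ket_eq_ofInt, inner_ofInt,
    Finset.sum_eq_single (⟨a - firstLabel p, by omega⟩ : Fin (dims p))]
  · simp [ketInt, Nat.add_sub_cancel' h₁]
  · intro i _ hi
    have : firstLabel p + i ≠ a := fun h => hi (Fin.ext (by simp [← h]))
    simp [ketInt, this]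
  · simp

/-- Each column is a product basis vector. Two different columns are orthogonal already at a party
of the group other than `rest`, whose labels differ. -/
theorem dominoIsometry_isometry (hlabel : Function.Injective label)
    (hrange : ∀ i k, firstLabel i ≤ dominoLabel label rest fixed i k ∧
      dominoLabel label rest fixed i k < firstLabel i + dims i)
    (q : Bool) (hq : ∃ i, f i = q ∧ i ≠ rest) :
    (dominoIsometry f label rest fixed q)ᴴ * dominoIsometry f label rest fixed q = 1 := by
  ext k l
  have : ((dominoIsometry f label rest fixed q)ᴴ * dominoIsometry f label rest fixed q) k l
      = inner ℂ
        (productVec fun i : {i : Fin 3 // f i = q} => ket (dominoLabel label rest fixed i k) i)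
        (productVec fun i : {i : Fin 3 // f i = q} => ket (dominoLabel label rest fixed i l) i) := by
    rw [EuclideanSpace.inner_eq_star_dotProduct, dotProduct_comm]
    rfl
  rw [this, inner_productVec]
  simp only [inner_ket _ (hrange _ _).1 (hrange _ _).2]
  rw [one_apply]
  split_ifs with h
  · simp [h]
  · obtain ⟨i, hi, hne⟩ := hq
    refine Finset.prod_eq_zero (Finset.mem_univ ⟨i, hi⟩) ?_
    simp [dominoLabel, hne, hlabel.eq_iff, h]

/-- The factor of party `i` in a state with coefficients `c` on the domino subspaces. -/
def dominoFactor (c : Bool → Fin 3 → ℂ) (i : Fin 3) : EuclideanSpace ℂ (Fin (dims i)) :=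
  if i = rest then ket fixed i else ∑ k, c (f i) k • ket (label k) i

/-- Each group has exactly one party besides `rest`, so the product over the group has a single
factor depending on `k`, and the sum over `k` can be moved into that factor. `rest` may lie in
either group. -/
theorem columnProduct_dominoIsometry
    (hf : ∀ q, ∃ i, (f i = q ∧ i ≠ rest) ∧ ∀ j, f j = q → j ≠ rest → j = i)
    (c : Bool → Fin 3 → ℂ) :
    LOCCProtocol.columnProduct (dominoIsometry f label rest fixed) c
      = groupParties f (productVec (dominoFactor f label rest fixed c)) := by
  rw [groupParties_productVec, LOCCProtocol.columnProduct]
  congr 1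
  funext q
  obtain ⟨i₀, ⟨hq, hne⟩, huniq⟩ := hf q
  ext x
  simp only [mulVec, dotProduct, dominoIsometry, of_apply, productVec]
  rw [← Finset.mul_prod_erase _ _ (Finset.mem_univ (⟨i₀, hq⟩ : {i : Fin 3 // f i = q}))]
  simp only [← Finset.mul_prod_erase _ _ (Finset.mem_univ (⟨i₀, hq⟩ : {i : Fin 3 // f i = q}))]
  have hrest : ∀ i ∈ Finset.univ.erase (⟨i₀, hq⟩ : {i : Fin 3 // f i = q}), i.1 = rest := by
    intro i hi
    by_contra h
    exact Finset.ne_of_mem_erase hi (Subtype.ext (huniq i.1 i.2 h))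
  have hfactor : ∀ i ∈ Finset.univ.erase (⟨i₀, hq⟩ : {i : Fin 3 // f i = q}),
      dominoFactor f label rest fixed c i (x i) = ket fixed i (x i) := fun i hi => by
    rw [dominoFactor, if_pos (hrest i hi)]
  have hlabel : ∀ k, ∀ i ∈ Finset.univ.erase (⟨i₀, hq⟩ : {i : Fin 3 // f i = q}),
      ket (dominoLabel label rest fixed i k) i (x i) = ket fixed i (x i) := fun k i hi => by
    rw [dominoLabel, if_pos (hrest i hi)]
  rw [Finset.prod_congr rfl hfactor]
  simp only [dominoFactor, if_neg hne, hq]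
  rw [WithLp.ofLp_sum, Finset.sum_apply, Finset.sum_mul]
  refine Finset.sum_congr rfl fun k _ => ?_
  rw [Finset.prod_congr rfl (hlabel k)]
  simp only [dominoLabel, if_neg hne, PiLp.smul_apply, smul_eq_mul]
  ring

end Grouping

theorem groupParties_smul (f : Fin 3 → Bool) (a : ℂ)
    (ψ : StateVec fun p : Fin 3 => Fin (dims p)) :
    groupParties f (a • ψ) = a • groupParties f ψ := rfl

/-- With Bob-2 at `|4⟩` and labels 1, 2, 3 for Alice and Bob-1, the dominoes are the families built
from `α` and `β` with last factor `|4⟩`. -/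
theorem not_loccDistinguishable_of_ne_one {f : Fin 3 → Bool} (hf : f 1 ≠ f 0) :
    ¬ LOCCDistinguishable (groupParties f '' SigmaSet) := by
  have key : ∀ f : Fin 3 → Bool, f 1 ≠ f 0 →
      ∀ q, ∃ i, (f i = q ∧ i ≠ 2) ∧ ∀ j, f j = q → j ≠ 2 → j = i := by decide
  have huniq := key f hf
  refine Domino.not_loccDistinguishable (V := dominoIsometry f ![1, 2, 3] 2 4)
    (fun q => dominoIsometry_isometry f _ _ _ (by decide) (by decide) q
      ((huniq q).imp fun _ h => h.1))
    (f 0) fun ⟨t, s⟩ => ?_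
  rw [columnProduct_dominoIsometry _ _ _ _ huniq, ← groupParties_smul]
  refine Set.mem_image_of_mem _ (Or.inl ⟨s, ?_⟩)
  fin_cases t
  · refine Or.inl ?_
    ext x
    simp [tri_apply, productVec, Fin.prod_univ_three, dominoFactor, Domino.coeff, hf,
      Domino.left, Domino.right, Domino.leftInt, Domino.rightInt, Fin.sum_univ_three,
      alpha, pair]
    ring
  · refine Or.inr (Or.inl ?_)
    ext x
    simp [tri_apply, productVec, Fin.prod_univ_three, dominoFactor, Domino.coeff, hf,
      Domino.left, Domino.right, Domino.leftInt, Domino.rightInt, Fin.sum_univ_three,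
      alpha, pair]
    ring
  · refine Or.inr (Or.inr (Or.inl ?_))
    ext x
    simp [tri_apply, productVec, Fin.prod_univ_three, dominoFactor, Domino.coeff, hf,
      Domino.left, Domino.right, Domino.leftInt, Domino.rightInt, Fin.sum_univ_three,
      beta, pair]
    ring
  · refine Or.inr (Or.inr (Or.inr (Or.inl ?_)))
    ext x
    simp [tri_apply, productVec, Fin.prod_univ_three, dominoFactor, Domino.coeff, hf,
      Domino.left, Domino.right, Domino.leftInt, Domino.rightInt, Fin.sum_univ_three,
      beta, pair]
    ring

/-- With Bob-1 at `|3⟩` and labels 1, 2, 4 for Alice and Bob-2, the dominoes are the families built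
from `α` and `γ` with middle factor `|3⟩`; `|α±⟩|3⟩|4⟩` serves in both cases. -/
theorem not_loccDistinguishable_of_ne_two {f : Fin 3 → Bool} (hf : f 2 ≠ f 0) :
    ¬ LOCCDistinguishable (groupParties f '' SigmaSet) := by
  have key : ∀ f : Fin 3 → Bool, f 2 ≠ f 0 →
      ∀ q, ∃ i, (f i = q ∧ i ≠ 1) ∧ ∀ j, f j = q → j ≠ 1 → j = i := by decide
  have huniq := key f hf
  refine Domino.not_loccDistinguishable (V := dominoIsometry f ![1, 2, 4] 1 3)
    (fun q => dominoIsometry_isometry f _ _ _ (by decide) (by decide) q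
      ((huniq q).imp fun _ h => h.1))
    (f 0) fun ⟨t, s⟩ => ?_
  rw [columnProduct_dominoIsometry _ _ _ _ huniq, ← groupParties_smul]
  refine Set.mem_image_of_mem _ (Or.inl ⟨s, ?_⟩)
  fin_cases t
  · refine Or.inr (Or.inr (Or.inr (Or.inr (Or.inr (Or.inr ?_)))))
    ext x
    simp [tri_apply, productVec, Fin.prod_univ_three, dominoFactor, Domino.coeff, hf,
      Domino.left, Domino.right, Domino.leftInt, Domino.rightInt, Fin.sum_univ_three,
      alpha, pair]
    ring
  · refine Or.inr (Or.inl ?_)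
    ext x
    simp [tri_apply, productVec, Fin.prod_univ_three, dominoFactor, Domino.coeff, hf,
      Domino.left, Domino.right, Domino.leftInt, Domino.rightInt, Fin.sum_univ_three,
      alpha, pair]
    ring
  · refine Or.inr (Or.inr (Or.inr (Or.inr (Or.inl ?_))))
    ext x
    simp [tri_apply, productVec, Fin.prod_univ_three, dominoFactor, Domino.coeff, hf,
      Domino.left, Domino.right, Domino.leftInt, Domino.rightInt, Fin.sum_univ_three,
      gamma, pair]
    ring
  · refine Or.inr (Or.inr (Or.inr (Or.inr (Or.inr (Or.inl ?_)))))
    ext x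
    simp [tri_apply, productVec, Fin.prod_univ_three, dominoFactor, Domino.coeff, hf,
      Domino.left, Domino.right, Domino.leftInt, Domino.rightInt, Fin.sum_univ_three,
      gamma, pair]
    ring

theorem exists_eq_productVec {ψ : StateVec fun p : Fin 3 => Fin (dims p)} (hψ : ψ ∈ SigmaSet) :
    ∃ φ : ∀ p, EuclideanSpace ℂ (Fin (dims p)), ψ = productVec φ := by
  rcases hψ with ⟨s, h⟩ | ⟨i, j, k, hk, h⟩ <;>
    rcases h with rfl | rfl | rfl | rfl | rfl | rfl | rfl <;> exact ⟨_, rfl⟩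

end SigmaStates

end

theorem proposition4 : IsGNPS SigmaStates.SigmaSet := by
  refine ⟨fun ψ hψ => ?_, fun ψ hψ => SigmaStates.exists_eq_productVec hψ,
    fun ψ hψ φ hφ hne => ?_, fun f hf => ?_⟩
  · obtain ⟨t, rfl⟩ := SigmaStates.exists_eq_state hψ
    have h : ‖SigmaStates.state t‖ ^ 2 = 1 := by
      rw [norm_sq_eq_re_inner (𝕜 := ℂ), SigmaStates.inner_state, if_pos rfl]
      simp
    exact (pow_eq_one_iff_of_nonneg (norm_nonneg _) two_ne_zero).1 h
  · obtain ⟨t, rfl⟩ := SigmaStates.exists_eq_state hψ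
    obtain ⟨u, rfl⟩ := SigmaStates.exists_eq_state hφ
    rw [SigmaStates.inner_state, if_neg fun h => hne (congrArg _ h)]
  -- If both Bobs were on Alice's side, `f` would be constant, against surjectivity.
  · by_cases h : f 1 = f 0
    · refine SigmaStates.not_loccDistinguishable_of_ne_two fun h' => ?_
      obtain ⟨i, hi⟩ := hf (!f 0)
      fin_cases i <;> simp_all
    · exact SigmaStates.not_loccDistinguishable_of_ne_one h
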